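/- Let $r\ge 0$ and $f\in C_b[0,\infty)$. Let $B$ be a one-dimensional Brownian motion with $B_0=0$, normalised so that $B_t$ has density $e^{-z^2/(4t)}/\sqrt{4\pi t}$ for $t>0$ (so $\mathbf E[B_t^2]=2t$), and let $N$ be a Poisson process of intensity $r$ independent of $B$ ($N\equiv 0$ if $r=0$). For $x\ge 0$ let $X$ be the Brownian motion with resetting to zero started at $x$, i.e. the càdlàg process satisfying $$X_t = x + B_t-\int_{(0,t]} X_{s-}\,dN_s ,\qquad t\ge 0,$$ and let $X^+_t=|X_t|$ be the reflecting Brownian motion on $[0,\infty)$ with Poissonian resetting to zero at rate $r$; $\mathbf E_x$ denotes expectation for the starting point $x$. Put $$u(t,x)=\mathbf E_x\big[f(X^+_t)\big],\qquad t\ge 0,\ x\ge 0 .$$ Then $u$ is well defined, is continuous on $[0,\infty)\times[0,\infty)$, satisfies $|u(t,x)|\le\|f\|_\infty$ for all $t,x\ge0$, and $u(t,\cdot)\in C^2(0,\infty)$ for every $t>0$. Moreover $u$ is a classical solution of $$\begin{cases}\dfrac{\partial u}{\partial t}(t,x)=\dfrac{\partial^2 u}{\partial x^2}(t,x)+r\,\big(u(t,0)-u(t,x)\big),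 & t>0,\ x>0,\\[1ex] \dfrac{\partial u}{\partial x}(t,0)=0, & t>0,\\[1ex] u(0,x)=f(x), & x\ge 0,\end{cases}$$ where $\partial u/\partial x(t,0)$ is the right derivative at $x=0$. It is the only bounded solution: if $v$ is a bounded continuous function on $[0,\infty)\times[0,\infty)$ with $v(t,\cdot)\in C^2(0,\infty)$ for every $t>0$ that satisfies the same three conditions (with $\partial v/\partial t$ existing for $t,x>0$), then $v=u$ on $[0,\infty)\times[0,\infty)$. -/

import Mathlib

open MeasureTheory ProbabilityTheory Set Filter Topology
open scoped NNReal BoundedContinuousFunction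

/-- Brownian motion run at twice the standard speed: `B t` has the density
`z ↦ exp (-z ^ 2 / (4 * t)) / √(4 * π * t)`, so that its generator is `d²/dx²`. -/
def IsFastBrownian {Ω : Type*} [MeasurableSpace Ω]
    (B : ℝ≥0 → Ω → ℝ) (P : Measure Ω) : Prop :=
  IsBrownianReal (fun t ω => B t ω / √2) P

/-- `N` is a Poisson process of intensity `r` under `P` (for `r = 0` it is almost surely
identically zero). The subtraction of natural numbers in `law_increment` is a genuine one
almost surely, since the paths are nondecreasing. -/
structure IsPoissonProcess {Ω : Type*} [MeasurableSpace Ω]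
    (r : ℝ≥0) (N : ℝ≥0 → Ω → ℕ) (P : Measure Ω) : Prop where
  start_zero : ∀ᵐ ω ∂P, N 0 ω = 0
  indep_increments : HasIndepIncrements (fun t ω => (N t ω : ℝ)) P
  law_increment : ∀ s t : ℝ≥0, s ≤ t →
    HasLaw (fun ω => N t ω - N s ω) (poissonMeasure (r * (t - s))) P
  mono_paths : ∀ᵐ ω ∂P, Monotone fun t => N t ω
  right_cont : ∀ᵐ ω ∂P, ∀ t : ℝ≥0, ContinuousWithinAt (fun s => N s ω) (Ici t) t
  unit_jumps : ∀ᵐ ω ∂P, ∀ t : ℝ≥0,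
    (N t ω : ℝ) ≤ Function.leftLim (fun s => (N s ω : ℝ)) t + 1

/-- The pathwise integral `∫_{(0,t]} H dn` against a right-continuous nondecreasing
`ℕ`-valued path `n`, which has only finitely many jumps in `(0,t]`. -/
noncomputable def jumpIntegral (H : ℝ≥0 → ℝ) (n : ℝ≥0 → ℕ) (t : ℝ≥0) : ℝ :=
  ∑ᶠ s ∈ Ioc (0 : ℝ≥0) t, H s * ((n s : ℝ) - Function.leftLim (fun q => (n q : ℝ)) s)

/-- `Y` is a càdlàg solution of the jump equation
`dY_t = dB_t + (xr - Y_{t-}) dN_t`, `Y_0 = x`. -/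
structure SolvesResettingSDE {Ω : Type*} [MeasurableSpace Ω] (x xr : ℝ)
    (B : ℝ≥0 → Ω → ℝ) (N : ℝ≥0 → Ω → ℕ) (Y : ℝ≥0 → Ω → ℝ) (P : Measure Ω) : Prop where
  right_cont : ∀ᵐ ω ∂P, ∀ t : ℝ≥0, ContinuousWithinAt (fun s => Y s ω) (Ici t) t
  left_lim : ∀ᵐ ω ∂P, ∀ t : ℝ≥0, ∃ l : ℝ, Tendsto (fun s => Y s ω) (𝓝[<] t) (𝓝 l)
  equation : ∀ᵐ ω ∂P, ∀ t : ℝ≥0,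
    Y t ω = x + B t ω +
      jumpIntegral (fun s => xr - Function.leftLim (fun q => Y q ω) s) (fun s => N s ω) t

/-- Under `P`, `Y` is Brownian motion started at `x` with Poissonian resetting to `xr`
at rate `r`. -/
def IsResettingBrownian {Ω : Type*} [MeasurableSpace Ω] (r : ℝ≥0) (x xr : ℝ)
    (Y : ℝ≥0 → Ω → ℝ) (P : Measure Ω) : Prop :=
  ∃ (B : ℝ≥0 → Ω → ℝ) (N : ℝ≥0 → Ω → ℕ),
    IsFastBrownian B P ∧ IsPoissonProcess r N P ∧
    IndepFun (fun ω t => B t ω) (fun ω t => N t ω) P ∧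
    SolvesResettingSDE x xr B N Y P

/-- Under `P`, `X` is reflecting Brownian motion on `[0,∞)` started at `x` with Poissonian
resetting to zero at rate `r`: Brownian motion with resetting to zero, reflected at the origin.
Between two consecutive resetting times it is of the form `|B_t - B_T|`, `T` being the earlier
of the two, that is, a reflecting Brownian motion restarted from zero. -/
def IsReflectingResettingBrownian {Ω : Type*} [MeasurableSpace Ω] (r x : ℝ≥0)
    (X : ℝ≥0 → Ω → ℝ≥0) (P : Measure Ω) : Prop :=
  ∃ Y : ℝ≥0 → Ω → ℝ, IsResettingBrownian r x 0 Y P ∧ ∀ t ω, (X t ω : ℝ) = |Y t ω|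

/-- `u` is a classical solution on `[0,∞) × [0,∞)` (first variable time, second variable space)
of `u_t = u_xx + r (u(t,0) - u(t,x))` with the Neumann condition `u_x(t,0) = 0` and the initial
datum `f`. The values of `u` off the closed quadrant play no role. -/
structure IsResettingHeatSolution (r : ℝ≥0) (f : ℝ≥0 →ᵇ ℝ) (u : ℝ → ℝ → ℝ) : Prop where
  cont : ContinuousOn (Function.uncurry u) (Ici (0 : ℝ) ×ˢ Ici (0 : ℝ))
  contDiff_space : ∀ t : ℝ, 0 < t → ContDiffOn ℝ 2 (u t) (Ioi 0)
  equation : ∀ t x : ℝ, 0 < t → 0 < x →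
    HasDerivAt (fun s => u s x) (deriv (deriv (u t)) x + r * (u t 0 - u t x)) t
  neumann : ∀ t : ℝ, 0 < t → HasDerivWithinAt (u t) 0 (Ici 0) 0
  initial : ∀ x : ℝ≥0, u 0 x = f x

/-!
Well-posedness of the heat equation with resetting, and its probabilistic representation.

The jump equation is solved path by path: before the first jump of `N` the solution is `x + B`, and
after a jump at `τ` it is `B - B τ` up to the next jump (`resettingPath_eq`). The time elapsed
since the last reset is exponential of rate `r`, truncated at `t`, and independent of `B`, so that
with the heat semigroup `heat` and the even extension `F` of `f`,

`u(t, x) = exp (-r t) * heat F t x + ∫ s in 0..t, r * exp (-r s) * heat F s 0`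

(`IsResettingBrownian.integral_comp`). The last reset time is never treated as a random variable:
it is located in a cell of a finite grid, by events about increments of `N`, and the mesh tends to
zero; both the paths and the expectations converge, the latter as Riemann-Stieltjes sums.

The integral term depends on `t` only and equals `u(t, 0) - exp (-r t) * heat F t 0`, so the
equation for `u` follows from the heat equation for `heat F`, proved by differentiating the Gaussian
kernel under the integral sign, and the Neumann condition follows because `heat F t` is even.

Uniqueness is a maximum principle (`IsResettingHeatSolution.le_of_bounded`). The nonlocal term
`r (u(t, 0) - u(t, x))` is nonpositive where `u(t, ·)` is maximal, and the penalisation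
`(x - 1)² + (3 + r) t` confines maxima to a compact set and also excludes them from the boundary
`x = 0`, where its slope is not zero.
-/

/-! ### Pathwise solution of the jump equation -/

/-- A nondecreasing path has no jump at `s` if it takes the value `n s` before `s`. -/
lemma Monotone.leftLim_natCast_eq {n : ℝ≥0 → ℕ} (hn : Monotone n) {a s : ℝ≥0} (has : a < s)
    (h : n a = n s) : Function.leftLim (fun q => (n q : ℝ)) s = n s := by
  have hm : Monotone fun q => (n q : ℝ) := fun a b hab => Nat.cast_le.2 (hn hab)
  refine le_antisymm (hm.leftLim_le le_rfl) ?_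
  have := hm.le_leftLim has
  simpa [h] using this

/-- The path is injective on its jump times, and bounded by `n t` on `(0, t]`. -/
lemma Monotone.finite_jumps {n : ℝ≥0 → ℕ} (hn : Monotone n) (t : ℝ≥0) :
    {s ∈ Ioc 0 t | (n s : ℝ) - Function.leftLim (fun q => (n q : ℝ)) s ≠ 0}.Finite := by
  refine Set.Finite.of_finite_image (f := n) ((finite_Iic (n t)).subset ?_) ?_
  · rintro _ ⟨s, hs, rfl⟩
    exact hn hs.1.2
  · intro a ha b hb hab
    by_contra hne
    rcases lt_or_gt_of_ne hne with h | h
    · exact hb.2 (sub_eq_zero.2 (hn.leftLim_natCast_eq h hab).symm)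
    · exact ha.2 (sub_eq_zero.2 (hn.leftLim_natCast_eq h hab.symm).symm)

/-- If the only possible jump of `n` in `(s, t]` is at `t`, then the integral over `(0, t]` is the
integral over `(0, s]` plus the contribution of the jump at `t`. -/
lemma jumpIntegral_eq_add {n : ℝ≥0 → ℕ} (hn : Monotone n) (H : ℝ≥0 → ℝ) {s t : ℝ≥0} (hst : s < t)
    (h : ∀ q ∈ Ioo s t, n s = n q) :
    jumpIntegral H n t = jumpIntegral H n s
      + H t * ((n t : ℝ) - Function.leftLim (fun q => (n q : ℝ)) t) := by
  have hsplit : Ioc 0 t = Ioc 0 s ∪ Ioc s t := (Ioc_union_Ioc_eq_Ioc (by simp) hst.le).symm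
  have hfin : ∀ a b : ℝ≥0, (Ioc a b ∩ Function.support fun q =>
      H q * ((n q : ℝ) - Function.leftLim (fun q => (n q : ℝ)) q)).Finite := by
    intro a b
    refine (hn.finite_jumps b).subset ?_
    rintro q ⟨hq, hq'⟩
    exact ⟨⟨pos_of_gt hq.1, hq.2⟩, right_ne_zero_of_mul hq'⟩
  unfold jumpIntegral
  rw [hsplit, finsum_mem_union' (Ioc_disjoint_Ioc_of_le le_rfl) (hfin _ _) (hfin _ _)]
  congr 1
  have : ∑ᶠ q ∈ Ioc s t, H q * ((n q : ℝ) - Function.leftLim (fun q => (n q : ℝ)) q)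
      = ∑ᶠ q ∈ ({t} : Set ℝ≥0),
        H q * ((n q : ℝ) - Function.leftLim (fun q => (n q : ℝ)) q) := by
    refine finsum_mem_inter_support_eq' _ _ _ fun q hq => ?_
    have hq' := right_ne_zero_of_mul hq
    constructor
    · rintro ⟨h1, h2⟩
      by_contra h3
      exact hq' (sub_eq_zero.2
        (hn.leftLim_natCast_eq h1 (h q ⟨h1, lt_of_le_of_ne h2 h3⟩)).symm)
    · rintro rfl
      exact ⟨hst, le_rfl⟩
  rw [this, finsum_mem_singleton]

lemma jumpIntegral_eq_of_eq {n : ℝ≥0 → ℕ} (hn : Monotone n) (H : ℝ≥0 → ℝ) {s t : ℝ≥0}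
    (hst : s ≤ t) (h : n s = n t) : jumpIntegral H n t = jumpIntegral H n s := by
  rcases hst.eq_or_lt with rfl | hst
  · rfl
  rw [jumpIntegral_eq_add hn H hst fun q hq =>
      le_antisymm (hn hq.1.le) (h ▸ hn hq.2.le), hn.leftLim_natCast_eq hst h]
  simp

/-- A right-continuous nondecreasing path has a last jump time before `t`, unless it is constant
on `[0, t]`. -/
lemma exists_last_jump {n : ℝ≥0 → ℕ} (hn : Monotone n)
    (hrc : ∀ t, ContinuousWithinAt n (Ici t) t) {t : ℝ≥0} (h0 : n 0 ≠ n t) :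
    ∃ τ, 0 < τ ∧ τ ≤ t ∧ n τ = n t ∧ ∀ s < τ, n s < n t := by
  set S := {s | n t ≤ n s} with hS
  have htS : t ∈ S := le_refl (n t)
  have hlt : ∀ s < sInf S, n s < n t := fun s hs => not_le.1 fun h =>
    absurd (csInf_le (OrderBot.bddBelow S) (show s ∈ S from h)) (not_le.2 hs)
  have hle : sInf S ≤ t := csInf_le (OrderBot.bddBelow S) htS
  have hval : n (sInf S) = n t := by
    refine le_antisymm (hn hle) ?_
    have hev : ∀ᶠ s in 𝓝[≥] (sInf S), n s = n (sInf S) :=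
      (hrc (sInf S)).eventually (p := (· = n (sInf S))) (by simp [nhds_discrete])
    have hcl : ∃ᶠ s in 𝓝[≥] (sInf S), s ∈ S := by
      have := (isGLB_csInf ⟨t, htS⟩ (OrderBot.bddBelow S)).frequently_mem ⟨t, htS⟩
      exact this
    obtain ⟨s, hs1, hs2⟩ := (hcl.and_eventually hev).exists
    exact hs2 ▸ hs1
  refine ⟨sInf S, pos_iff_ne_zero.2 fun h => ?_, hle, hval, hlt⟩
  rw [h] at hval
  exact h0 hval

/-- The jump equation is solved by hand: before the first jump of `n` the solution is `x + b`, and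
afterwards it is the increment of `b` since the last jump `τ`, because the jump at `τ` is exactly
`-y (τ-)`, so that `y τ = 0`. -/
lemma resettingPath_eq {n : ℝ≥0 → ℕ} {b y : ℝ≥0 → ℝ} {x : ℝ} (hn : Monotone n)
    (hrc : ∀ t, ContinuousWithinAt n (Ici t) t)
    (hunit : ∀ t, (n t : ℝ) ≤ Function.leftLim (fun s => (n s : ℝ)) t + 1)
    (hb : Continuous b)
    (hll : ∀ t : ℝ≥0, ∃ l : ℝ, Tendsto y (𝓝[<] t) (𝓝 l))
    (heq : ∀ t, y t = x + b t + jumpIntegral (fun s => 0 - Function.leftLim y s) n t) (t : ℝ≥0) :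
    (n 0 = n t → y t = x + b t) ∧
    (n 0 ≠ n t → ∃ τ, 0 < τ ∧ τ ≤ t ∧ n τ = n t ∧ (∀ s < τ, n s < n t) ∧ y t = b t - b τ) := by
  refine ⟨fun h => ?_, fun h => ?_⟩
  · rw [heq, jumpIntegral_eq_of_eq hn _ (zero_le) h]
    simp [jumpIntegral]
  obtain ⟨τ, hτ0, hτt, hτ, hlt⟩ := exists_last_jump hn hrc h
  refine ⟨τ, hτ0, hτt, hτ, hlt, ?_⟩
  have hne : (𝓝[<] τ).NeBot := nhdsLT_neBot_of_exists_lt ⟨0, hτ0⟩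
  have hm : Monotone fun q => (n q : ℝ) := fun a b hab => Nat.cast_le.2 (hn hab)
  -- The path is integer-valued and its jump at `τ` is at most `1`, hence exactly `1`.
  have hjump : Function.leftLim (fun q => (n q : ℝ)) τ = n t - 1 := by
    refine le_antisymm ?_ (by have := hunit τ; rw [hτ] at this; linarith)
    refine le_of_tendsto (hm.tendsto_leftLim τ) ?_
    filter_upwards [self_mem_nhdsWithin] with s hs
    have := hlt s hs
    have : ((n s + 1 : ℕ) : ℝ) ≤ n t := Nat.cast_le.2 this
    push_cast at this
    linarith
  have hev : ∀ᶠ s in 𝓝[<] τ, n s + 1 = n t := by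
    have h1 := (hm.tendsto_leftLim τ).eventually (lt_mem_nhds (a := (n t : ℝ) - 2)
      (by rw [hjump]; linarith))
    filter_upwards [h1, self_mem_nhdsWithin] with s hs hs'
    have h2 := hlt s hs'
    have : ((n t : ℕ) : ℝ) < (n s + 2 : ℕ) := by push_cast; linarith
    have := Nat.cast_lt.1 this
    omega
  obtain ⟨l, hl⟩ := hll τ
  have hlim : Function.leftLim y τ = l := leftLim_eq_of_tendsto hl
  -- The equations at `τ` and at `s < τ` close to `τ` differ by the increment of `b` and one jump.
  have hyτ : y τ = 0 := by
    have hev2 : ∀ᶠ s in 𝓝[<] τ, y τ = y s + (b τ - b s) - l := by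
      filter_upwards [hev, self_mem_nhdsWithin] with s hs hs'
      rw [heq τ, heq s, jumpIntegral_eq_add hn _ hs' (fun q hq => ?_), hjump, hτ, hlim]
      · ring
      · have h1 := hn hq.1.le
        have h2 := hlt q hq.2
        omega
    have hconst : Tendsto (fun _ : ℝ≥0 => y τ) (𝓝[<] τ) (𝓝 (l + (b τ - b τ) - l)) := by
      refine Tendsto.congr' (hev2.mono fun s hs => hs.symm) ?_
      exact (hl.add (tendsto_const_nhds.sub
        (hb.continuousAt.tendsto.mono_left nhdsWithin_le_nhds))).sub tendsto_const_nhds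
    have := tendsto_nhds_unique tendsto_const_nhds hconst
    rw [this]; ring
  have h1 := heq t
  have h2 := heq τ
  rw [jumpIntegral_eq_of_eq hn _ hτt hτ] at h1
  linarith

/-! ### Sums over a grid -/

lemma grid_le {t : ℝ} (ht : 0 ≤ t) {m k : ℕ} (hk : k ≤ m + 1) : k * (t / (m + 1)) ≤ t := by
  have : (k : ℝ) ≤ m + 1 := by exact_mod_cast hk
  rw [← mul_div_assoc, div_le_iff₀ (by positivity), mul_comm]
  exact mul_le_mul_of_nonneg_left this ht

/-- For the step function `J` that jumps from `0` to `1` at `τ`, the increments of `J` along the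
grid `k t / (m + 1)` single out the first grid point after `τ`. -/
lemma exists_sum_grid_eq {t τ : ℝ} (hτ : 0 < τ) (hτt : τ ≤ t) (m : ℕ) :
    ∃ s, τ ≤ s ∧ s ≤ t ∧ s ≤ τ + t / (m + 1) ∧ ∀ J φ : ℝ → ℝ,
      (∀ q, 0 ≤ q → q < τ → J q = 0) → (∀ q, τ ≤ q → q ≤ t → J q = 1) →
      ∑ k ∈ Finset.range (m + 1),
        (J ((k + 1 : ℕ) * (t / (m + 1))) - J (k * (t / (m + 1)))) *
          φ ((k + 1 : ℕ) * (t / (m + 1))) = φ s := by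
  set δ : ℝ := t / (m + 1) with hδ
  have ht : 0 < t := hτ.trans_le hτt
  have hδ0 : 0 < δ := by positivity
  have hmδ : ((m + 1 : ℕ) : ℝ) * δ = t := by rw [hδ]; push_cast; field_simp
  have hex : ∃ k : ℕ, τ ≤ k * δ := ⟨m + 1, by rw [hmδ]; exact hτt⟩
  classical
  obtain ⟨k, hk⟩ : ∃ k, Nat.find hex = k + 1 := by
    refine Nat.exists_eq_succ_of_ne_zero fun h => ?_
    have := Nat.find_spec hex
    rw [h] at this
    simp at this
    linarith
  have hspec : τ ≤ ((k + 1 : ℕ) : ℝ) * δ := hk ▸ Nat.find_spec hex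
  have hmin : (k : ℝ) * δ < τ := not_le.1 (Nat.find_min hex (m := k) (by omega))
  have hkm : k + 1 ≤ m + 1 := hk ▸ Nat.find_min' hex (by rw [hmδ]; exact hτt)
  have hmono : ∀ {a b : ℕ}, a ≤ b → (a : ℝ) * δ ≤ b * δ := fun h =>
    mul_le_mul_of_nonneg_right (Nat.cast_le.2 h) hδ0.le
  refine ⟨(k + 1 : ℕ) * δ, hspec, hmδ ▸ hmono hkm, by push_cast; linarith, ?_⟩
  intro J φ h0 h1
  rw [Finset.sum_eq_single_of_mem k (Finset.mem_range.2 hkm)]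
  · rw [h1 _ hspec (hmδ ▸ hmono hkm), h0 _ (by positivity) hmin]
    ring
  · intro j hj hjk
    have hjm : j + 1 ≤ m + 1 := Finset.mem_range.1 hj
    rcases lt_or_gt_of_ne hjk with h | h
    · rw [h0 _ (by positivity) ((hmono (show j + 1 ≤ k from h)).trans_lt hmin),
        h0 _ (by positivity) ((hmono h.le).trans_lt hmin)]
      ring
    · rw [h1 _ (hspec.trans (hmono (show k + 1 ≤ j + 1 by omega))) (hmδ ▸ hmono hjm),
        h1 _ (hspec.trans (hmono (show k + 1 ≤ j from h))) (hmδ ▸ hmono (show j ≤ m + 1 by omega))]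
      ring

lemma tendsto_sum_grid {t τ : ℝ} (hτ : 0 < τ) (hτt : τ ≤ t) {J φ : ℝ → ℝ}
    (h0 : ∀ q, 0 ≤ q → q < τ → J q = 0) (h1 : ∀ q, τ ≤ q → q ≤ t → J q = 1)
    (hφ : Continuous φ) :
    Tendsto (fun m : ℕ => ∑ k ∈ Finset.range (m + 1),
        (J ((k + 1 : ℕ) * (t / (m + 1))) - J (k * (t / (m + 1)))) *
          φ ((k + 1 : ℕ) * (t / (m + 1)))) atTop (𝓝 (φ τ)) := by
  choose s hs1 _ hs3 hs4 using exists_sum_grid_eq hτ hτt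
  have hlim : Tendsto s atTop (𝓝 τ) := by
    refine tendsto_of_tendsto_of_tendsto_of_le_of_le tendsto_const_nhds ?_ hs1 hs3
    have : Tendsto (fun m : ℕ => τ + t * (1 / ((m : ℝ) + 1))) atTop (𝓝 (τ + t * 0)) :=
      (tendsto_one_div_add_atTop_nhds_zero_nat.const_mul t).const_add τ
    simpa [div_eq_mul_inv] using this
  refine ((hφ.tendsto τ).comp hlim).congr fun m => ?_
  exact (hs4 m J φ h0 h1).symm

lemma abs_sum_grid_le {t τ : ℝ} (hτ : 0 < τ) (hτt : τ ≤ t) {J φ : ℝ → ℝ}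
    (h0 : ∀ q, 0 ≤ q → q < τ → J q = 0) (h1 : ∀ q, τ ≤ q → q ≤ t → J q = 1) {M : ℝ}
    (hM : ∀ q, |φ q| ≤ M) (m : ℕ) :
    |∑ k ∈ Finset.range (m + 1),
        (J ((k + 1 : ℕ) * (t / (m + 1))) - J (k * (t / (m + 1)))) *
          φ ((k + 1 : ℕ) * (t / (m + 1)))| ≤ M := by
  obtain ⟨s, _, _, _, hs⟩ := exists_sum_grid_eq hτ hτt m
  rw [hs J φ h0 h1]
  exact hM s

/-- Riemann-Stieltjes sums converge. The sums are averages over the jump time `τ` of the grid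
sums of step functions, with respect to `E' τ dτ`. -/
lemma tendsto_sum_sub_mul {t : ℝ} (ht : 0 ≤ t) {E E' φ : ℝ → ℝ}
    (hE : ∀ s, HasDerivAt E (E' s) s) (hE' : Continuous E') (hφ : Continuous φ) {M : ℝ}
    (hM : ∀ q, |φ q| ≤ M) :
    Tendsto (fun m : ℕ => ∑ k ∈ Finset.range (m + 1),
        (E ((k + 1 : ℕ) * (t / (m + 1))) - E (k * (t / (m + 1)))) *
          φ ((k + 1 : ℕ) * (t / (m + 1)))) atTop (𝓝 (∫ s in (0 : ℝ)..t, E' s * φ s)) := by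
  set J : ℝ → ℝ → ℝ := fun τ => (Ici τ).indicator 1 with hJ
  have hint : ∀ q, IntegrableOn (fun τ => E' τ * J τ q) (Ioc 0 t) := by
    intro q
    have hi : IntegrableOn E' (Ioc 0 t) := hE'.integrableOn_Ioc
    have : (fun τ => E' τ * J τ q) = (Iic q).indicator E' := by
      ext τ
      simp only [hJ, indicator_apply, mem_Ici, mem_Iic, Pi.one_apply]
      split_ifs <;> simp
    rw [this]
    exact hi.indicator measurableSet_Iic
  have hEq : ∀ q, 0 ≤ q → q ≤ t → E q - E 0 = ∫ τ in Ioc 0 t, E' τ * J τ q := by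
    intro q hq0 hqt
    have : (fun τ => E' τ * J τ q) = (Iic q).indicator E' := by
      ext τ
      simp only [hJ, indicator_apply, mem_Ici, mem_Iic, Pi.one_apply]
      split_ifs <;> simp
    rw [this, setIntegral_indicator measurableSet_Iic, Ioc_inter_Iic, min_eq_right hqt,
      ← intervalIntegral.integral_of_le hq0]
    exact (intervalIntegral.integral_eq_sub_of_hasDerivAt (fun s _ => hE s)
      (hE'.intervalIntegrable _ _)).symm
  have hsum : ∀ m : ℕ, ∑ k ∈ Finset.range (m + 1),
        (E ((k + 1 : ℕ) * (t / (m + 1))) - E (k * (t / (m + 1)))) *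
          φ ((k + 1 : ℕ) * (t / (m + 1))) = ∫ τ in Ioc 0 t, E' τ * ∑ k ∈ Finset.range (m + 1),
        (J τ ((k + 1 : ℕ) * (t / (m + 1))) - J τ (k * (t / (m + 1)))) *
          φ ((k + 1 : ℕ) * (t / (m + 1))) := by
    intro m
    have e : ∀ τ, E' τ * ∑ k ∈ Finset.range (m + 1),
        (J τ ((k + 1 : ℕ) * (t / (m + 1))) - J τ (k * (t / (m + 1)))) *
          φ ((k + 1 : ℕ) * (t / (m + 1))) = ∑ k ∈ Finset.range (m + 1),
        (E' τ * J τ ((k + 1 : ℕ) * (t / (m + 1))) - E' τ * J τ (k * (t / (m + 1)))) *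
          φ ((k + 1 : ℕ) * (t / (m + 1))) := by
      intro τ
      rw [Finset.mul_sum]
      exact Finset.sum_congr rfl fun k _ => by ring
    simp_rw [e]
    rw [integral_finsetSum]
    swap
    · exact fun k _ => ((hint _).sub (hint _)).mul_const _
    refine Finset.sum_congr rfl fun k hk => ?_
    have hk' : k + 1 ≤ m + 1 := Finset.mem_range.1 hk
    rw [integral_mul_const, integral_sub (hint _) (hint _),
      ← hEq _ (by positivity) (grid_le ht hk'), ← hEq _ (by positivity) (grid_le ht (by omega))]
    ring
  have hJ0 : ∀ τ q, 0 ≤ q → q < τ → J τ q = 0 := fun τ q _ h => by simp [hJ, h]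
  have hJ1 : ∀ τ q, τ ≤ q → q ≤ t → J τ q = 1 := fun τ q h _ => by simp [hJ, h]
  simp_rw [hsum]
  rw [intervalIntegral.integral_of_le ht]
  refine tendsto_integral_of_dominated_convergence (fun τ => |E' τ| * M) (fun m => ?_)
    (hE'.abs.integrableOn_Ioc.mul_const M) (fun m => ?_) ?_
  · refine hE'.aestronglyMeasurable.mul (Finset.aestronglyMeasurable_fun_sum _ fun k _ => ?_)
    have hm : ∀ q, Measurable fun τ => J τ q := fun q => by
      have : (fun τ => J τ q) = (Iic q).indicator 1 := by
        ext τ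
        simp [hJ, indicator_apply]
      rw [this]
      exact measurable_one.indicator measurableSet_Iic
    exact (((hm _).sub (hm _)).mul_const _).aestronglyMeasurable
  · filter_upwards [ae_restrict_mem measurableSet_Ioc] with τ hτ
    rw [norm_mul]
    exact mul_le_mul_of_nonneg_left (abs_sum_grid_le hτ.1 hτ.2 (hJ0 τ) (hJ1 τ) hM m) (abs_nonneg _)
  · filter_upwards [ae_restrict_mem measurableSet_Ioc] with τ hτ
    exact (tendsto_sum_grid hτ.1 hτ.2 (hJ0 τ) (hJ1 τ) hφ).const_mul _

/-! ### The heat semigroup -/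

/-- The heat semigroup of `d²/dx²`: the mean of `F` under the normal law with mean `x` and variance
`2 t`. For `t ≤ 0` it is `F x`. -/
noncomputable def heat (F : ℝ → ℝ) (t x : ℝ) : ℝ :=
  ∫ y, F y ∂gaussianReal x (2 * t).toNNReal

lemma heat_eq_integral_std {F : ℝ → ℝ} (hF : Continuous F) (t x : ℝ) :
    heat F t x = ∫ z, F (x + √(2 * t) * z) ∂gaussianReal 0 1 := by
  have h : gaussianReal x (2 * t).toNNReal
      = (gaussianReal 0 1).map (fun z => x + √(2 * t) * z) := by
    have e : (fun z => x + √(2 * t) * z) = (x + ·) ∘ (√(2 * t) * ·) := rfl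
    rw [e, ← Measure.map_map (by fun_prop) (by fun_prop), gaussianReal_map_const_mul,
      gaussianReal_map_const_add]
    congr 1
    · simp
    · ext
      rcases le_total 0 t with ht | ht
      · have h2 : 0 ≤ 2 * t := by linarith
        simp [-Nat.ofNat_nonneg, -Real.sqrt_mul, Real.sq_sqrt h2, Real.coe_toNNReal _ h2]
      · have h2 : 2 * t ≤ 0 := by linarith
        simp [-Nat.ofNat_nonneg, -Real.sqrt_mul, Real.sqrt_eq_zero_of_nonpos h2,
          Real.toNNReal_of_nonpos h2]
  rw [heat, h, integral_map (by fun_prop) hF.aestronglyMeasurable]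

lemma continuous_heat {F : ℝ → ℝ} (hF : Continuous F) {M : ℝ} (hM : ∀ y, |F y| ≤ M) :
    Continuous (Function.uncurry (heat F)) := by
  have : Function.uncurry (heat F)
      = fun p : ℝ × ℝ => ∫ z, F (p.2 + √(2 * p.1) * z) ∂gaussianReal 0 1 := by
    ext p
    exact heat_eq_integral_std hF _ _
  rw [this]
  refine continuous_of_dominated (bound := fun _ => M) (fun p => ?_) (fun p => ?_)
    (integrable_const _) ?_
  · exact (hF.comp (by fun_prop)).aestronglyMeasurable
  · exact Eventually.of_forall fun z => hM _
  · exact Eventually.of_forall fun z => hF.comp (by fun_prop)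

lemma abs_heat_le {F : ℝ → ℝ} {M : ℝ} (hM : ∀ y, |F y| ≤ M) (t x : ℝ) : |heat F t x| ≤ M := by
  have := norm_integral_le_of_norm_le_const (μ := gaussianReal x (2 * t).toNNReal)
    (f := F) (Eventually.of_forall hM)
  simpa [heat] using this

lemma heat_neg {F : ℝ → ℝ} (hF : Continuous F) (heven : ∀ y, F (-y) = F y) (t x : ℝ) :
    heat F t (-x) = heat F t x := by
  have h : gaussianReal (-x) (2 * t).toNNReal
      = (gaussianReal x (2 * t).toNNReal).map (fun y => -y) := gaussianReal_map_neg.symm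
  rw [heat, h, integral_map (by fun_prop) hF.aestronglyMeasurable]
  simp only [heven, heat]

/-! ### Kernels with Gaussian decay -/

lemma abs_mul_exp_neg_mul_sq_le {A b : ℝ} (hA : 0 ≤ A) (hb : 0 < b) {p z : ℝ}
    (hp : |p| ≤ A * (1 + z ^ 2)) :
    |p| * Real.exp (-b * z ^ 2) ≤ A * (1 + 2 / b) * Real.exp (-(b / 2) * z ^ 2) := by
  have h1 : 1 + b / 2 * z ^ 2 ≤ Real.exp (b / 2 * z ^ 2) := by
    linarith [Real.add_one_le_exp (b / 2 * z ^ 2)]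
  have h2 : 1 + z ^ 2 ≤ (1 + 2 / b) * (1 + b / 2 * z ^ 2) := by
    have : (1 + 2 / b) * (1 + b / 2 * z ^ 2) = 1 + z ^ 2 + 2 / b + b / 2 * z ^ 2 := by
      field_simp
      ring
    have : 0 ≤ 2 / b := by positivity
    have : 0 ≤ b / 2 * z ^ 2 := by positivity
    linarith
  have h3 : Real.exp (-b * z ^ 2) = Real.exp (-(b / 2) * z ^ 2) * Real.exp (-(b / 2) * z ^ 2) := by
    rw [← Real.exp_add]; ring_nf
  have h4 : Real.exp (b / 2 * z ^ 2) * Real.exp (-(b / 2) * z ^ 2) = 1 := by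
    rw [← Real.exp_add]; simp
  calc |p| * Real.exp (-b * z ^ 2)
      ≤ A * ((1 + 2 / b) * Real.exp (b / 2 * z ^ 2)) * Real.exp (-b * z ^ 2) := by
        gcongr
        refine hp.trans ?_
        gcongr
        exact h2.trans (by gcongr)
    _ = A * (1 + 2 / b) * Real.exp (-(b / 2) * z ^ 2)
        * (Real.exp (b / 2 * z ^ 2) * Real.exp (-(b / 2) * z ^ 2)) := by rw [h3]; ring
    _ = _ := by rw [h4, mul_one]

lemma integrable_of_abs_le_exp {k : ℝ → ℝ} (hk : Continuous k) {C b : ℝ} (hb : 0 < b)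
    (h : ∀ z, |k z| ≤ C * Real.exp (-b * z ^ 2)) : Integrable k :=
  ((integrable_exp_neg_mul_sq hb).const_mul C).mono' hk.aestronglyMeasurable
    (Eventually.of_forall h)

lemma integrable_mul_comp_sub {F k : ℝ → ℝ} (hF : Continuous F) {M : ℝ} (hM : ∀ y, |F y| ≤ M)
    (hk : Integrable k) (x : ℝ) : Integrable fun y => F y * k (x - y) :=
  (hk.comp_sub_left x).bdd_mul hF.aestronglyMeasurable (Eventually.of_forall hM)

lemma continuous_integral_mul_comp_sub {F k : ℝ → ℝ} (hF : Continuous F) {M : ℝ}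
    (hM : ∀ y, |F y| ≤ M) (hk : Integrable k) : Continuous fun x => ∫ y, F y * k (x - y) := by
  have h : (fun x => ∫ y, F y * k (x - y)) = fun x => ∫ y, F (x - y) * k y := by
    ext x
    -- The parameter is moved from the kernel, which need not be continuous, to `F`.
    rw [← integral_sub_left_eq_self _ volume x]
    simp
  rw [h]
  refine continuous_of_dominated (bound := fun y => M * |k y|) (fun x => ?_) (fun x => ?_)
    (hk.abs.const_mul M) ?_
  · exact (hF.comp (by fun_prop)).aestronglyMeasurable.mul hk.aestronglyMeasurable
  · refine Eventually.of_forall fun y => ?_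
    rw [norm_mul]
    exact mul_le_mul_of_nonneg_right (hM _) (abs_nonneg _)
  · exact Eventually.of_forall fun y => (hF.comp (by fun_prop)).mul continuous_const

/-- Convolution with a kernel whose derivative has Gaussian decay may be differentiated under the
integral sign, without any smoothness of `F`. -/
lemma hasDerivAt_integral_mul_comp_sub {F k k' : ℝ → ℝ} (hF : Continuous F) {M : ℝ}
    (hM : ∀ y, |F y| ≤ M) (hk : ∀ z, HasDerivAt k (k' z) z) (hk' : Continuous k')
    (hint : Integrable k) {C b : ℝ} (hb : 0 < b)
    (hdecay : ∀ z, |k' z| ≤ C * Real.exp (-b * z ^ 2)) (x : ℝ) :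
    HasDerivAt (fun x => ∫ y, F y * k (x - y)) (∫ y, F y * k' (x - y)) x := by
  have hM0 : 0 ≤ M := (abs_nonneg _).trans (hM 0)
  have hC0 : 0 ≤ C := by
    have := (abs_nonneg _).trans (hdecay 0)
    simpa using this
  have hkc : Continuous k := continuous_iff_continuousAt.2 fun z => (hk z).continuousAt
  refine (hasDerivAt_integral_of_dominated_loc_of_deriv_le (μ := volume)
    (F := fun x y => F y * k (x - y)) (F' := fun x y => F y * k' (x - y))
    (x₀ := x) (s := Metric.ball x 1)
    (bound := fun y => M * (C * Real.exp b * Real.exp (-(b / 2) * (x - y) ^ 2)))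
    (Metric.ball_mem_nhds x one_pos) ?_ (integrable_mul_comp_sub hF hM hint x) ?_ ?_ ?_ ?_).2
  · exact Eventually.of_forall fun x' => (hF.mul (hkc.comp (by fun_prop))).aestronglyMeasurable
  · exact (hF.mul (hk'.comp (by fun_prop))).aestronglyMeasurable
  · refine Eventually.of_forall fun y x' hx' => ?_
    rw [norm_mul]
    refine mul_le_mul (hM y) ((hdecay _).trans ?_) (abs_nonneg _) hM0
    rw [mul_assoc, ← Real.exp_add]
    refine mul_le_mul_of_nonneg_left (Real.exp_le_exp.2 ?_) hC0
    rw [Metric.mem_ball, Real.dist_eq] at hx'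
    have h1 : (x' - x) ^ 2 ≤ 1 := by
      rw [← sq_abs]; nlinarith [abs_nonneg (x' - x)]
    -- `(x - y)² ≤ 2 (x' - y)² + 2 (x' - x)²`
    have h2 : (x - y) ^ 2 ≤ 2 * (x' - y) ^ 2 + 2 := by
      nlinarith [sq_nonneg ((x' - y) + (x' - x))]
    nlinarith
  · exact (((integrable_exp_neg_mul_sq (half_pos hb)).comp_sub_left x).const_mul _).const_mul _
  · refine Eventually.of_forall fun y x' _ => ?_
    have := (hk (x' - y)).comp x' ((hasDerivAt_id x').sub_const y)
    exact (this.congr_deriv (by ring)).const_mul (F y)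

/-! ### The heat kernel -/

/-- The heat kernel of `d²/dx²`. -/
noncomputable def heatKernel (t z : ℝ) : ℝ := (√(4 * Real.pi * t))⁻¹ * Real.exp (-(4 * t)⁻¹ * z ^ 2)

/-- The first spatial derivative of the heat kernel. -/
noncomputable def heatKernelDeriv (t z : ℝ) : ℝ := -z / (2 * t) * heatKernel t z

/-- The second spatial derivative of the heat kernel, which is also its time derivative. -/
noncomputable def heatKernelDeriv₂ (t z : ℝ) : ℝ :=
  (z ^ 2 / (4 * t ^ 2) - 1 / (2 * t)) * heatKernel t z

lemma continuous_heatKernel (t : ℝ) : Continuous (heatKernel t) := by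
  unfold heatKernel; fun_prop

lemma continuous_heatKernelDeriv (t : ℝ) : Continuous (heatKernelDeriv t) := by
  unfold heatKernelDeriv heatKernel; fun_prop

lemma continuous_heatKernelDeriv₂ (t : ℝ) : Continuous (heatKernelDeriv₂ t) := by
  unfold heatKernelDeriv₂ heatKernel; fun_prop

lemma hasDerivAt_heatKernel {t : ℝ} (ht : 0 < t) (z : ℝ) :
    HasDerivAt (heatKernel t) (heatKernelDeriv t z) z := by
  have := (((hasDerivAt_pow 2 z).const_mul (-(4 * t)⁻¹)).exp).const_mul (√(4 * Real.pi * t))⁻¹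
  refine this.congr_deriv ?_
  simp only [heatKernelDeriv, heatKernel]
  field_simp
  ring

lemma hasDerivAt_heatKernelDeriv {t : ℝ} (ht : 0 < t) (z : ℝ) :
    HasDerivAt (heatKernelDeriv t) (heatKernelDeriv₂ t z) z := by
  have := (((hasDerivAt_id z).neg).div_const (2 * t)).mul (hasDerivAt_heatKernel ht z)
  refine this.congr_deriv ?_
  simp only [heatKernelDeriv, heatKernelDeriv₂, Pi.neg_apply, id]
  field_simp
  ring

lemma hasDerivAt_heatKernel_time {t : ℝ} (ht : 0 < t) (z : ℝ) :
    HasDerivAt (fun s => heatKernel s z) (heatKernelDeriv₂ t z) t := by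
  have h4 : 0 < 4 * Real.pi * t := by positivity
  have hs : √(4 * Real.pi * t) ≠ 0 := (Real.sqrt_pos.2 h4).ne'
  have d1 := (((hasDerivAt_id t).const_mul (4 * Real.pi)).sqrt h4.ne').inv hs
  have d2 := (((((hasDerivAt_id t).const_mul 4).inv (by simp [ht.ne'])).neg).mul_const (z ^ 2)).exp
  refine (d1.mul d2).congr_deriv ?_
  have hsq : √(4 * Real.pi * t) ^ 2 = 4 * Real.pi * t := Real.sq_sqrt h4.le
  simp only [heatKernelDeriv₂, heatKernel, id, Pi.neg_apply, Pi.inv_apply, hsq]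
  field_simp
  ring

/-- Near time `t` the heat kernel times a quadratic factor is bounded by one Gaussian. -/
lemma exists_abs_mul_heatKernel_le {t A : ℝ} (ht : 0 < t) (hA : 0 ≤ A) :
    ∃ C b, 0 < b ∧ ∀ s p z : ℝ, t / 2 ≤ s → s ≤ 3 / 2 * t → |p| ≤ A * (1 + z ^ 2) →
      |p * heatKernel s z| ≤ C * Real.exp (-b * z ^ 2) := by
  refine ⟨(√(2 * Real.pi * t))⁻¹ * (A * (1 + 2 / (6 * t)⁻¹)), (6 * t)⁻¹ / 2, by positivity,
    fun s p z h1 h2 hp => ?_⟩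
  have hs : 0 < s := by linarith
  have h3 : (√(4 * Real.pi * s))⁻¹ ≤ (√(2 * Real.pi * t))⁻¹ := by
    have : 0 < √(2 * Real.pi * t) := Real.sqrt_pos.2 (by positivity)
    gcongr ?_⁻¹
    refine Real.sqrt_le_sqrt ?_
    nlinarith [Real.pi_pos]
  have h4 : Real.exp (-(4 * s)⁻¹ * z ^ 2) ≤ Real.exp (-(6 * t)⁻¹ * z ^ 2) := by
    refine Real.exp_le_exp.2 (mul_le_mul_of_nonneg_right (neg_le_neg ?_) (sq_nonneg z))
    exact inv_anti₀ (by positivity) (by linarith)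
  rw [abs_mul, heatKernel, abs_of_nonneg (by positivity : (0 : ℝ) ≤ (√(4 * Real.pi * s))⁻¹ * _),
    mul_left_comm, mul_assoc (√(2 * Real.pi * t))⁻¹]
  refine mul_le_mul h3 ?_ (by positivity) (by positivity)
  exact (mul_le_mul_of_nonneg_left h4 (abs_nonneg p)).trans
    (abs_mul_exp_neg_mul_sq_le hA (inv_pos.2 (by positivity)) hp)

lemma exists_abs_heatKernel_le {t : ℝ} (ht : 0 < t) :
    ∃ C b, 0 < b ∧ ∀ z, |heatKernel t z| ≤ C * Real.exp (-b * z ^ 2) := by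
  obtain ⟨C, b, hb, hC⟩ := exists_abs_mul_heatKernel_le ht zero_le_one
  refine ⟨C, b, hb, fun z => ?_⟩
  rw [← one_mul (heatKernel t z)]
  exact hC t 1 z (by linarith) (by linarith)
    (by rw [abs_one]; nlinarith [sq_nonneg z])

lemma exists_abs_heatKernelDeriv_le {t : ℝ} (ht : 0 < t) :
    ∃ C b, 0 < b ∧ ∀ z, |heatKernelDeriv t z| ≤ C * Real.exp (-b * z ^ 2) := by
  obtain ⟨C, b, hb, hC⟩ := exists_abs_mul_heatKernel_le (A := 1 / (2 * t)) ht (by positivity)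
  refine ⟨C, b, hb, fun z => ?_⟩
  refine hC t _ z (by linarith) (by linarith) ?_
  rw [abs_div, abs_neg, abs_of_pos (by positivity : 0 < 2 * t), div_mul_eq_mul_div, one_mul]
  gcongr
  nlinarith [sq_abs z, sq_nonneg (|z| - 1)]

/-- The Gaussian bound for the second derivative, locally uniformly in time. -/
lemma exists_abs_heatKernelDeriv₂_le {t : ℝ} (ht : 0 < t) :
    ∃ C b, 0 < b ∧ ∀ s, t / 2 ≤ s → s ≤ 3 / 2 * t →
      ∀ z, |heatKernelDeriv₂ s z| ≤ C * Real.exp (-b * z ^ 2) := by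
  obtain ⟨C, b, hb, hC⟩ := exists_abs_mul_heatKernel_le (A := 1 / t ^ 2 + 1 / t) ht (by positivity)
  refine ⟨C, b, hb, fun s h1 h2 z => ?_⟩
  refine hC s _ z h1 h2 ?_
  have hs : 0 < s := by linarith
  have e1 : z ^ 2 / (4 * s ^ 2) ≤ 1 / t ^ 2 * z ^ 2 := by
    rw [div_mul_eq_mul_div, one_mul]
    refine div_le_div_of_nonneg_left (sq_nonneg z) (by positivity) ?_
    nlinarith
  have e2 : 1 / (2 * s) ≤ 1 / t := by
    refine div_le_div_of_nonneg_left zero_le_one ht (by linarith)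
  have e3 : 0 ≤ z ^ 2 / (4 * s ^ 2) := by positivity
  have e4 : 0 ≤ 1 / (2 * s) := by positivity
  have e5 : 0 ≤ 1 / t ^ 2 := by positivity
  have e6 : 0 ≤ 1 / t * z ^ 2 := by positivity
  rw [abs_le]
  constructor <;> nlinarith

/-! ### Regularity of the heat semigroup -/

lemma heat_eq_integral_heatKernel {t : ℝ} (ht : 0 < t) (F : ℝ → ℝ) (x : ℝ) :
    heat F t x = ∫ y, F y * heatKernel t (x - y) := by
  have hv : (2 * t).toNNReal ≠ 0 := by simpa using ht
  rw [heat, integral_gaussianReal_eq_integral_smul hv]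
  refine integral_congr_ae (Eventually.of_forall fun y => ?_)
  simp only [gaussianPDFReal, heatKernel, smul_eq_mul,
    Real.coe_toNNReal (2 * t) (by linarith)]
  have e1 : 2 * Real.pi * (2 * t) = 4 * Real.pi * t := by ring
  have e2 : -(y - x) ^ 2 / (2 * (2 * t)) = -(4 * t)⁻¹ * (x - y) ^ 2 := by field_simp; ring
  rw [e1, e2]
  ring

lemma hasDerivAt_heat {F : ℝ → ℝ} (hF : Continuous F) {M : ℝ} (hM : ∀ y, |F y| ≤ M) {t : ℝ}
    (ht : 0 < t) (x : ℝ) :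
    HasDerivAt (heat F t) (∫ y, F y * heatKernelDeriv t (x - y)) x := by
  obtain ⟨C, b, hb, hC⟩ := exists_abs_heatKernel_le ht
  obtain ⟨C', b', hb', hC'⟩ := exists_abs_heatKernelDeriv_le ht
  rw [funext (heat_eq_integral_heatKernel ht F)]
  exact hasDerivAt_integral_mul_comp_sub hF hM (hasDerivAt_heatKernel ht)
    (continuous_heatKernelDeriv t) (integrable_of_abs_le_exp (continuous_heatKernel t) hb hC)
    hb' hC' x

lemma hasDerivAt_deriv_heat {F : ℝ → ℝ} (hF : Continuous F) {M : ℝ} (hM : ∀ y, |F y| ≤ M) {t : ℝ}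
    (ht : 0 < t) (x : ℝ) :
    HasDerivAt (deriv (heat F t)) (∫ y, F y * heatKernelDeriv₂ t (x - y)) x := by
  obtain ⟨C, b, hb, hC⟩ := exists_abs_heatKernelDeriv_le ht
  obtain ⟨C', b', hb', hC'⟩ := exists_abs_heatKernelDeriv₂_le ht
  rw [funext fun x => (hasDerivAt_heat hF hM ht x).deriv]
  exact hasDerivAt_integral_mul_comp_sub hF hM (hasDerivAt_heatKernelDeriv ht)
    (continuous_heatKernelDeriv₂ t)
    (integrable_of_abs_le_exp (continuous_heatKernelDeriv t) hb hC) hb'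
    (hC' t (by linarith) (by linarith)) x

lemma contDiff_heat {F : ℝ → ℝ} (hF : Continuous F) {M : ℝ} (hM : ∀ y, |F y| ≤ M) {t : ℝ}
    (ht : 0 < t) : ContDiff ℝ 2 (heat F t) := by
  obtain ⟨C, b, hb, hC⟩ := exists_abs_heatKernelDeriv₂_le ht
  rw [show (2 : WithTop ℕ∞) = 1 + 1 by norm_num, contDiff_succ_iff_deriv]
  refine ⟨fun x => (hasDerivAt_heat hF hM ht x).differentiableAt, by simp, ?_⟩
  rw [contDiff_one_iff_deriv]
  refine ⟨fun x => (hasDerivAt_deriv_heat hF hM ht x).differentiableAt, ?_⟩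
  rw [funext fun x => (hasDerivAt_deriv_heat hF hM ht x).deriv]
  exact continuous_integral_mul_comp_sub hF hM (integrable_of_abs_le_exp
    (continuous_heatKernelDeriv₂ t) hb (hC t (by linarith) (by linarith)))

/-- The heat semigroup solves the heat equation. -/
lemma hasDerivAt_heat_time {F : ℝ → ℝ} (hF : Continuous F) {M : ℝ} (hM : ∀ y, |F y| ≤ M) {t : ℝ}
    (ht : 0 < t) (x : ℝ) :
    HasDerivAt (fun s => heat F s x) (deriv (deriv (heat F t)) x) t := by
  have hM0 : 0 ≤ M := (abs_nonneg _).trans (hM 0)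
  obtain ⟨C, b, hb, hC⟩ := exists_abs_heatKernel_le ht
  obtain ⟨C', b', hb', hC'⟩ := exists_abs_heatKernelDeriv₂_le ht
  rw [(hasDerivAt_deriv_heat hF hM ht x).deriv]
  have heq : (fun s => heat F s x) =ᶠ[𝓝 t] fun s => ∫ y, F y * heatKernel s (x - y) := by
    filter_upwards [Ioi_mem_nhds ht] with s hs using heat_eq_integral_heatKernel hs F x
  refine HasDerivAt.congr_of_eventuallyEq ?_ heq
  refine (hasDerivAt_integral_of_dominated_loc_of_deriv_le (μ := volume)
    (F := fun s y => F y * heatKernel s (x - y))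
    (F' := fun s y => F y * heatKernelDeriv₂ s (x - y))
    (x₀ := t) (s := Ioo (t / 2) (3 / 2 * t))
    (bound := fun y => M * (C' * Real.exp (-b' * (x - y) ^ 2)))
    (Ioo_mem_nhds (by linarith) (by linarith)) ?_
    (integrable_mul_comp_sub hF hM (integrable_of_abs_le_exp (continuous_heatKernel t) hb hC) x)
    ?_ ?_ ?_ ?_).2
  · exact Eventually.of_forall fun s =>
      (hF.mul ((continuous_heatKernel s).comp (by fun_prop))).aestronglyMeasurable
  · exact (hF.mul ((continuous_heatKernelDeriv₂ t).comp (by fun_prop))).aestronglyMeasurable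
  · refine Eventually.of_forall fun y s hs => ?_
    rw [norm_mul]
    exact mul_le_mul (hM y) (hC' s hs.1.le hs.2.le _) (abs_nonneg _) hM0
  · exact (((integrable_exp_neg_mul_sq hb').comp_sub_left x).const_mul _).const_mul _
  · refine Eventually.of_forall fun y s hs => ?_
    exact (hasDerivAt_heatKernel_time (by linarith [hs.1]) (x - y)).const_mul (F y)

/-- The heat semigroup maps even functions to even functions, whose slope at `0` vanishes. -/
lemma hasDerivAt_heat_zero {F : ℝ → ℝ} (hF : Continuous F) {M : ℝ} (hM : ∀ y, |F y| ≤ M)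
    (heven : ∀ y, F (-y) = F y) {t : ℝ} (ht : 0 < t) : HasDerivAt (heat F t) 0 0 := by
  have h := hasDerivAt_heat hF hM ht 0
  have h' : HasDerivAt (fun x => heat F t (-x)) (-∫ y, F y * heatKernelDeriv t (0 - y)) 0 := by
    have := HasDerivAt.comp (0 : ℝ) (by simpa using h) (hasDerivAt_neg (0 : ℝ))
    exact this.congr_deriv (by simp)
  rw [funext (heat_neg hF heven t)] at h'
  have := h.unique h'
  exact h.congr_deriv (by linarith)

/-! ### The law of Brownian motion with resetting at a fixed time -/

lemma IsFastBrownian.hasLaw {Ω : Type*} [MeasurableSpace Ω] {B : ℝ≥0 → Ω → ℝ} {P : Measure Ω}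
    (hB : IsFastBrownian B P) (t : ℝ≥0) :
    HasLaw (B t) (gaussianReal 0 (2 * (t : ℝ)).toNNReal) P := by
  have h := gaussianReal_const_mul (hB.hasLaw_eval t) (√2)
  convert h using 1
  · ext ω; field_simp
  · congr 1
    · simp
    · ext; simp

lemma IsFastBrownian.hasLaw_sub {Ω : Type*} [MeasurableSpace Ω] {B : ℝ≥0 → Ω → ℝ} {P : Measure Ω}
    (hB : IsFastBrownian B P) {s t : ℝ≥0} (hst : s ≤ t) :
    HasLaw (fun ω => B t ω - B s ω) (gaussianReal 0 (2 * ((t : ℝ) - s)).toNNReal) P := by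
  have hst' : (0 : ℝ) ≤ t - s := sub_nonneg.2 (NNReal.coe_le_coe.2 hst)
  have h := gaussianReal_const_mul (IsPreBrownianReal.hasLaw_sub hB.toIsPreBrownianReal t s) (√2)
  convert h using 1
  · ext ω; simp only [Pi.sub_apply]; field_simp
  · congr 1
    · simp
    · ext
      have : |(t : ℝ) - s| = t - s := abs_of_nonneg hst'
      simp [Real.dist_eq, this, hst]

lemma IsFastBrownian.continuous {Ω : Type*} [MeasurableSpace Ω] {B : ℝ≥0 → Ω → ℝ} {P : Measure Ω}
    (hB : IsFastBrownian B P) : ∀ᵐ ω ∂P, Continuous fun t => B t ω := by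
  filter_upwards [hB.cont] with ω hω
  have := hω.const_mul (√2)
  refine this.congr fun t => ?_
  field_simp

lemma integral_poissonMeasure_ite (r : ℝ≥0) :
    ∫ k, (if k = 0 then (1 : ℝ) else 0) ∂poissonMeasure r = Real.exp (-r) := by
  rw [integral_poissonMeasure, tsum_eq_single 0 fun k hk => by simp [hk]]
  simp

/-- The law at time `t` of Brownian motion with resetting: either no reset has happened, or the time
since the last reset has the exponential density on `[0, t]`.
Conditioning on the last reset time is done on a grid: the events that it lies in a given cell have
probabilities known from the increments of the Poisson process and are independent of the increments
of the Brownian motion; path continuity allows the passage to the limit. -/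
lemma IsResettingBrownian.integral_comp {Ω : Type*} [MeasurableSpace Ω] {P : Measure Ω} {r : ℝ≥0}
    {x : ℝ} {Y : ℝ≥0 → Ω → ℝ} (hY : IsResettingBrownian r x 0 Y P) {F : ℝ → ℝ} (hF : Continuous F)
    {M : ℝ} (hM : ∀ y, |F y| ≤ M) (t : ℝ≥0) :
    Integrable (fun ω => F (Y t ω)) P ∧
    ∫ ω, F (Y t ω) ∂P = Real.exp (-(r * t)) * heat F t x
      + ∫ s in (0 : ℝ)..t, r * Real.exp (-(r * s)) * heat F s 0 := by
  obtain ⟨B, N, hB, hN, hind, hS⟩ := hY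
  have hP : IsProbabilityMeasure P := (hB.hasLaw t).isProbabilityMeasure
  have ht0 : (0 : ℝ) ≤ t := t.2
  -- `J ω q` is the indicator of no reset in `(q, t]`.
  set J : Ω → ℝ → ℝ := fun ω q => if N t ω - N q.toNNReal ω = 0 then 1 else 0 with hJ
  set D : Ω → ℝ → ℝ := fun ω q => F (B t ω - B q.toNNReal ω) with hD
  set Z : ℕ → Ω → ℝ := fun m ω => J ω 0 * F (x + B t ω) + ∑ k ∈ Finset.range (m + 1),
    (J ω ((k + 1 : ℕ) * (t / (m + 1))) - J ω (k * (t / (m + 1)))) *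
      D ω ((k + 1 : ℕ) * (t / (m + 1))) with hZ
  have hle : ∀ {q : ℝ}, q ≤ t → q.toNNReal ≤ t := fun h => Real.toNNReal_le_iff_le_coe.2 h
  have hJm : ∀ q : ℝ, q ≤ t → AEStronglyMeasurable (fun ω => J ω q) P := fun q hq =>
    ((Measurable.of_discrete (f := fun k : ℕ => if k = 0 then (1 : ℝ) else 0)).comp_aemeasurable
      (hN.law_increment _ _ (hle hq)).aemeasurable).aestronglyMeasurable
  have hDm : ∀ q : ℝ, AEStronglyMeasurable (fun ω => D ω q) P := fun q =>
    (hF.measurable.comp_aemeasurable ((hB.hasLaw t).aemeasurable.sub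
      (hB.hasLaw _).aemeasurable)).aestronglyMeasurable
  have hXm : AEStronglyMeasurable (fun ω => F (x + B t ω)) P :=
    (hF.measurable.comp_aemeasurable
      ((hB.hasLaw t).aemeasurable.const_add x)).aestronglyMeasurable
  have hJ_le : ∀ ω q, |J ω q| ≤ 1 := fun ω q => by
    simp only [hJ]; split_ifs <;> simp
  have hXi : Integrable (fun ω => F (x + B t ω)) P :=
    Integrable.of_bound hXm M (Eventually.of_forall fun ω => hM _)
  have hDi : ∀ q : ℝ, Integrable (fun ω => D ω q) P := fun q =>
    Integrable.of_bound (hDm q) M (Eventually.of_forall fun ω => hM _)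
  have hJXi : ∀ q : ℝ, q ≤ t → Integrable (fun ω => J ω q * F (x + B t ω)) P := fun q hq =>
    hXi.bdd_mul (hJm q hq) (Eventually.of_forall fun ω => hJ_le ω q)
  have hJDi : ∀ q q' : ℝ, q ≤ t → Integrable (fun ω => J ω q * D ω q') P := fun q q' hq =>
    (hDi q').bdd_mul (hJm q hq) (Eventually.of_forall fun ω => hJ_le ω q)
  have hZm : ∀ m, AEStronglyMeasurable (Z m) P := fun m =>
    ((hJm 0 ht0).mul hXm).add (Finset.aestronglyMeasurable_fun_sum _ fun k hk =>
      ((hJm _ (grid_le ht0 (Finset.mem_range.1 hk))).sub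
        (hJm _ (grid_le ht0 (Finset.mem_range.1 hk).le))).mul (hDm _))
  have hpath : ∀ᵐ ω ∂P, (∀ m, ‖Z m ω‖ ≤ M) ∧
      Tendsto (fun m => Z m ω) atTop (𝓝 (F (Y t ω))) := by
    filter_upwards [hN.start_zero, hN.mono_paths, hN.right_cont, hN.unit_jumps, hB.continuous,
      hS.left_lim, hS.equation] with ω h0 hmono hrc hunit hb hll heq
    obtain ⟨hno, hyes⟩ := resettingPath_eq hmono hrc hunit hb hll heq t
    simp only [h0] at hno hyes
    by_cases hNt : 0 = N t ω
    · have hJ1 : ∀ q, J ω q = 1 := fun q => by simp [hJ, ← hNt]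
      have hZ1 : ∀ m, Z m ω = F (Y t ω) := fun m => by simp [hZ, hJ1, hno hNt]
      simp only [hZ1]
      exact ⟨fun _ => hM _, tendsto_const_nhds⟩
    · obtain ⟨τ, hτ0, hτt, hτ, hlt, hYt⟩ := hyes hNt
      have hJ0 : J ω 0 = 0 := by simp [hJ, h0, Ne.symm hNt]
      have e0 : ∀ q, 0 ≤ q → q < (τ : ℝ) → J ω q = 0 := fun q hq hqτ => by
        have := hlt q.toNNReal ((Real.toNNReal_lt_iff_lt_coe hq).2 hqτ)
        simp only [hJ]
        rw [if_neg (by omega)]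
      have e1 : ∀ q, (τ : ℝ) ≤ q → q ≤ t → J ω q = 1 := fun q hq hqt => by
        have := hmono (NNReal.le_toNNReal_of_coe_le hq)
        simp only [hJ]
        rw [if_pos (by simp only at this; omega)]
      have hDc : Continuous (D ω) :=
        hF.comp (continuous_const.sub (hb.comp continuous_real_toNNReal))
      have hτ0' : (0 : ℝ) < τ := hτ0
      have hτt' : (τ : ℝ) ≤ t := hτt
      simp only [hZ, hJ0, zero_mul, zero_add]
      refine ⟨abs_sum_grid_le hτ0' hτt' e0 e1 fun q => hM _, ?_⟩
      have := tendsto_sum_grid hτ0' hτt' e0 e1 hDc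
      simpa only [hD, Real.toNNReal_coe, hYt] using this
  have hYm : AEStronglyMeasurable (fun ω => F (Y t ω)) P :=
    aestronglyMeasurable_of_tendsto_ae atTop hZm (hpath.mono fun ω h => h.2)
  have hM' : ∀ᵐ ω ∂P, ‖F (Y t ω)‖ ≤ M := Eventually.of_forall fun ω => hM _
  refine ⟨Integrable.of_bound hYm M hM', ?_⟩
  have hEJ : ∀ q : ℝ, 0 ≤ q → q ≤ t → ∫ ω, J ω q ∂P = Real.exp (-(r * (t - q))) := by
    intro q hq0 hq
    have := (hN.law_increment _ _ (hle hq)).integral_comp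
      (f := fun k : ℕ => if k = 0 then (1 : ℝ) else 0)
      Measurable.of_discrete.aestronglyMeasurable
    simp only [Function.comp_def] at this
    rw [this, integral_poissonMeasure_ite]
    simp [NNReal.coe_sub (hle hq), hq0]
  have hmul : ∀ q : ℝ, 0 ≤ q → q ≤ t → ∀ g : (ℝ≥0 → ℝ) → ℝ, Measurable g →
      AEStronglyMeasurable (fun ω => g fun s => B s ω) P →
      ∫ ω, J ω q * g (fun s => B s ω) ∂P
        = Real.exp (-(r * (t - q))) * ∫ ω, g (fun s => B s ω) ∂P := by
    intro q hq0 hq g hg hgm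
    have hi : IndepFun (fun ω => J ω q) (fun ω => g fun s => B s ω) P :=
      hind.symm.comp (φ := fun n : ℝ≥0 → ℕ => if n t - n q.toNNReal = 0 then (1 : ℝ) else 0)
        ((Measurable.of_discrete (f := fun k : ℕ => if k = 0 then (1 : ℝ) else 0)).comp
          ((measurable_pi_apply t).sub (measurable_pi_apply _))) hg
    rw [hi.integral_fun_mul_eq_mul_integral (hJm q hq) hgm, hEJ q hq0 hq]
  have hEX : ∫ ω, F (x + B t ω) ∂P = heat F t x := by
    have := (gaussianReal_const_add (hB.hasLaw t) x).integral_comp (f := F)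
      hF.aestronglyMeasurable
    simpa [Function.comp_def, heat] using this
  have hED : ∀ q : ℝ, 0 ≤ q → q ≤ t → ∫ ω, D ω q ∂P = heat F (t - q) 0 := by
    intro q hq0 hq
    have := (hB.hasLaw_sub (hle hq)).integral_comp (f := F) hF.aestronglyMeasurable
    simpa [Function.comp_def, heat, hq0] using this
  have hEZ : ∀ m, ∫ ω, Z m ω ∂P = Real.exp (-(r * t)) * heat F t x
      + ∑ k ∈ Finset.range (m + 1),
        (Real.exp (-(r * (t - (k + 1 : ℕ) * (t / (m + 1)))))
          - Real.exp (-(r * (t - k * (t / (m + 1)))))) *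
            heat F (t - (k + 1 : ℕ) * (t / (m + 1))) 0 := by
    intro m
    have hi : ∀ k ∈ Finset.range (m + 1), Integrable (fun ω =>
        (J ω ((k + 1 : ℕ) * (t / (m + 1))) - J ω (k * (t / (m + 1)))) *
          D ω ((k + 1 : ℕ) * (t / (m + 1)))) P := fun k hk => by
      simp_rw [sub_mul]
      exact (hJDi _ _ (grid_le ht0 (Finset.mem_range.1 hk))).sub
        (hJDi _ _ (grid_le ht0 (Finset.mem_range.1 hk).le))
    simp only [hZ]
    rw [integral_add (hJXi 0 ht0) (integrable_finsetSum _ hi), integral_finsetSum _ hi]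
    congr 1
    · have ht : Measurable fun b : ℝ≥0 → ℝ => b t := measurable_pi_apply t
      rw [hmul 0 le_rfl ht0 (fun b => F (x + b t))
        (hF.measurable.comp (ht.const_add x)) hXm, hEX, sub_zero]
    · refine Finset.sum_congr rfl fun k hk => ?_
      have h1 := grid_le ht0 (Finset.mem_range.1 hk)
      have h2 := grid_le ht0 (Finset.mem_range.1 hk).le
      have hg : Measurable fun b : ℝ≥0 → ℝ =>
          F (b t - b (((k + 1 : ℕ) : ℝ) * (t / (m + 1))).toNNReal) :=
        hF.measurable.comp ((measurable_pi_apply t).sub (measurable_pi_apply _))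
      simp_rw [sub_mul]
      rw [integral_sub (hJDi _ _ h1) (hJDi _ _ h2), hmul _ (by positivity) h1 _ hg (hDm _),
        hmul _ (by positivity) h2 _ hg (hDm _), hED _ (by positivity) h1]
  have hlim₁ := tendsto_integral_of_dominated_convergence (fun _ => M) hZm (integrable_const M)
    (fun m => hpath.mono fun ω h => h.1 m) (hpath.mono fun ω h => h.2)
  have hlim₂ := (tendsto_sum_sub_mul ht0 (E := fun s => Real.exp (-(r * (t - s))))
    (E' := fun s => r * Real.exp (-(r * (t - s)))) (φ := fun s => heat F (t - s) 0)
    (fun s => by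
      have := (((hasDerivAt_id s).const_sub (t : ℝ)).const_mul (r : ℝ)).neg.exp
      exact this.congr_deriv (by simp; ring))
    (by fun_prop)
    ((continuous_heat hF hM).comp (f := fun s : ℝ => ((t : ℝ) - s, (0 : ℝ))) (by fun_prop))
    (fun q => abs_heat_le hM _ _)).const_add (Real.exp (-(r * t)) * heat F t x)
  simp_rw [hEZ] at hlim₁
  rw [tendsto_nhds_unique hlim₁ hlim₂]
  congr 1
  have := intervalIntegral.integral_comp_sub_left (a := 0) (b := (t : ℝ))
    (fun s => r * Real.exp (-(r * s)) * heat F s 0) (t : ℝ)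
  simpa using this

/-! ### The maximum principle -/

lemma HasDerivWithinAt.nonpos_of_eventually_le {g : ℝ → ℝ} {g' a : ℝ}
    (hg : HasDerivWithinAt g g' (Ici a) a) (h : ∀ᶠ y in 𝓝[>] a, g y ≤ g a) : g' ≤ 0 := by
  rw [hasDerivWithinAt_iff_tendsto_slope, Ici_sdiff_left] at hg
  refine le_of_tendsto hg ?_
  filter_upwards [h, self_mem_nhdsWithin] with y hy hay
  rw [slope_def_field]
  exact div_nonpos_of_nonpos_of_nonneg (sub_nonpos.2 hy) (sub_nonneg.2 (le_of_lt hay))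

lemma HasDerivWithinAt.nonneg_of_eventually_le {g : ℝ → ℝ} {g' a : ℝ}
    (hg : HasDerivWithinAt g g' (Iic a) a) (h : ∀ᶠ y in 𝓝[<] a, g y ≤ g a) : 0 ≤ g' := by
  rw [hasDerivWithinAt_iff_tendsto_slope, Iic_sdiff_right] at hg
  refine ge_of_tendsto hg ?_
  filter_upwards [h, self_mem_nhdsWithin] with y hy hay
  rw [slope_def_field]
  exact div_nonneg_of_nonpos (sub_nonpos.2 hy) (sub_nonpos.2 (le_of_lt hay))

/-- Two bounded solutions of the same problem are ordered. If `v₁ - v₂` were positive at `(t₁, x₁)`,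
then for small `ε` the penalised difference `v₁ - v₂ - ε ((x - 1)² + (3 + r) t)` would be positive
there and would have its maximum over a large rectangle `[0, t₁] × [0, R]` neither at the initial
time nor at `x = R`. At `x = 0` a maximum is excluded by the Neumann condition, since the
penalisation has slope `-2` there, and in the interior by the equation, where the resetting term
contributes at most `r ε`. -/
lemma IsResettingHeatSolution.le_of_bounded {r : ℝ≥0} {f : ℝ≥0 →ᵇ ℝ} {v₁ v₂ : ℝ → ℝ → ℝ}
    (h₁ : IsResettingHeatSolution r f v₁) (h₂ : IsResettingHeatSolution r f v₂) {C₁ C₂ : ℝ}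
    (hC₁ : ∀ t x : ℝ≥0, |v₁ t x| ≤ C₁) (hC₂ : ∀ t x : ℝ≥0, |v₂ t x| ≤ C₂) (t₁ x₁ : ℝ≥0) :
    v₁ t₁ x₁ ≤ v₂ t₁ x₁ := by
  by_contra! hlt
  set K : ℝ := (x₁ - 1) ^ 2 + (3 + r) * t₁ with hK
  have hK0 : 0 ≤ K := by positivity
  obtain ⟨ε, hε, hεK⟩ : ∃ ε > 0, ε * K < v₁ t₁ x₁ - v₂ t₁ x₁ := by
    refine ⟨(v₁ t₁ x₁ - v₂ t₁ x₁) / (2 * (K + 1)), div_pos (by linarith) (by linarith), ?_⟩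
    rw [div_mul_eq_mul_div, div_lt_iff₀ (by linarith)]
    nlinarith
  set C : ℝ := C₁ + C₂ with hC
  have hC0 : 0 ≤ C := add_nonneg ((abs_nonneg _).trans (hC₁ 0 0)) ((abs_nonneg _).trans (hC₂ 0 0))
  have hbd : ∀ t x : ℝ, 0 ≤ t → 0 ≤ x → v₁ t x - v₂ t x ≤ C := by
    intro t x ht hx
    have a₁ := (abs_le.1 (hC₁ ⟨t, ht⟩ ⟨x, hx⟩)).2
    have a₂ := (abs_le.1 (hC₂ ⟨t, ht⟩ ⟨x, hx⟩)).1
    change v₁ t x ≤ C₁ at a₁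
    change -C₂ ≤ v₂ t x at a₂
    linarith
  set R : ℝ := x₁ + 2 + C / ε with hR
  have hCε : 0 ≤ C / ε := by positivity
  have hx₁ : (0 : ℝ) ≤ x₁ := x₁.2
  have hR0 : 0 < R := by linarith
  set φ : ℝ × ℝ → ℝ := fun p =>
    v₁ p.1 p.2 - v₂ p.1 p.2 - ε * ((p.2 - 1) ^ 2 + (3 + r) * p.1) with hφ
  have hcont : ContinuousOn φ (Icc 0 (t₁ : ℝ) ×ˢ Icc 0 R) := by
    have hsub : Icc 0 (t₁ : ℝ) ×ˢ Icc 0 R ⊆ Ici (0 : ℝ) ×ˢ Ici (0 : ℝ) :=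
      prod_mono Icc_subset_Ici_self Icc_subset_Ici_self
    refine ((h₁.cont.mono hsub).sub (h₂.cont.mono hsub)).sub ?_
    fun_prop
  obtain ⟨⟨t, x⟩, ⟨⟨ht0, htt⟩, hx0, hxR⟩, hmax⟩ :=
    (isCompact_Icc.prod isCompact_Icc).exists_isMaxOn
      ⟨((t₁ : ℝ), (x₁ : ℝ)), ⟨⟨t₁.2, le_rfl⟩, hx₁, by simp only [hR]; linarith⟩⟩ hcont
  simp only at ht0 htt hx0 hxR
  have hmax' : ∀ s y : ℝ, 0 ≤ s → s ≤ t₁ → 0 ≤ y → y ≤ R → φ (s, y) ≤ φ (t, x) :=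
    fun s y a b c d => hmax ⟨⟨a, b⟩, c, d⟩
  have hpos : 0 < φ (t, x) := by
    refine lt_of_lt_of_le ?_ (hmax' t₁ x₁ t₁.2 le_rfl hx₁ (by simp only [hR]; linarith))
    simp only [hφ]
    linarith
  have hrt : 0 ≤ (3 + (r : ℝ)) * t := by positivity
  have htpos : 0 < t := by
    refine lt_of_le_of_ne ht0 fun h => ?_
    subst h
    have e₁ := h₁.initial ⟨x, hx0⟩
    have e₂ := h₂.initial ⟨x, hx0⟩
    change v₁ 0 x = _ at e₁
    change v₂ 0 x = _ at e₂
    simp only [hφ, e₁, e₂] at hpos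
    nlinarith [sq_nonneg (x - 1)]
  have hxlt : x < R := by
    refine lt_of_le_of_ne hxR fun h => ?_
    have h1 : C / ε ≤ (x - 1) ^ 2 := by
      have : 1 + C / ε ≤ x - 1 := by rw [h]; simp only [hR]; linarith
      nlinarith
    have h2 : C ≤ ε * (x - 1) ^ 2 := by
      rw [div_le_iff₀ hε] at h1; linarith
    have h3 := hbd t x ht0 hx0
    simp only [hφ] at hpos
    nlinarith
  rcases hx0.eq_or_lt with h0 | hxpos
  · subst h0
    have hd : HasDerivWithinAt (fun y => φ (t, y)) (2 * ε) (Ici 0) 0 := by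
      have hp : HasDerivWithinAt (fun y : ℝ => ε * ((y - 1) ^ 2 + (3 + r) * t)) (ε * (-2))
          (Ici 0) 0 := by
        have := ((((hasDerivAt_id (0 : ℝ)).sub_const 1).pow 2).add_const
          ((3 + (r : ℝ)) * t)).const_mul ε
        refine HasDerivAt.hasDerivWithinAt (this.congr_deriv ?_)
        simp
      exact (((h₁.neumann t htpos).sub (h₂.neumann t htpos)).sub hp).congr_deriv (by ring)
    have := hd.nonpos_of_eventually_le (by
      filter_upwards [Ioo_mem_nhdsGT hR0] with y hy using hmax' t y ht0 htt hy.1.le hy.2.le)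
    linarith
  have hloc : IsLocalMax (fun y => φ (t, y)) x := by
    filter_upwards [Ioo_mem_nhds hxpos hxlt] with y hy
    exact hmax' t y ht0 htt hy.1.le hy.2.le
  have hcd : ∀ v, IsResettingHeatSolution r f v →
      (∀ᶠ y in 𝓝 x, DifferentiableAt ℝ (v t) y) ∧ DifferentiableAt ℝ (deriv (v t)) x := by
    intro v hv
    have hC2 := hv.contDiff_space t htpos
    refine ⟨?_, ?_⟩
    · filter_upwards [Ioi_mem_nhds hxpos] with y hy
      exact (hC2.differentiableOn (by norm_num)).differentiableAt (Ioi_mem_nhds hy)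
    · have := hC2.deriv_of_isOpen (m := 1) isOpen_Ioi (by norm_num)
      exact (this.differentiableOn (by norm_num)).differentiableAt (Ioi_mem_nhds hxpos)
  obtain ⟨d₁, dd₁⟩ := hcd v₁ h₁
  obtain ⟨d₂, dd₂⟩ := hcd v₂ h₂
  have hderiv : ∀ᶠ y in 𝓝 x, HasDerivAt (fun y => φ (t, y))
      (deriv (v₁ t) y - deriv (v₂ t) y - ε * (2 * (y - 1))) y := by
    filter_upwards [d₁, d₂] with y e₁ e₂
    have := ((((hasDerivAt_id y).sub_const 1).pow 2).add_const ((3 + (r : ℝ)) * t)).const_mul ε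
    refine ((e₁.hasDerivAt.sub e₂.hasDerivAt).sub this).congr_deriv ?_
    simp
  have hderiv2 : deriv (deriv fun y => φ (t, y)) x
      = deriv (deriv (v₁ t)) x - deriv (deriv (v₂ t)) x - 2 * ε := by
    have he : deriv (fun y => φ (t, y)) =ᶠ[𝓝 x]
        fun y => deriv (v₁ t) y - deriv (v₂ t) y - ε * (2 * (y - 1)) :=
      hderiv.mono fun y hy => hy.deriv
    rw [he.deriv_eq]
    have := (((hasDerivAt_id x).sub_const 1).const_mul 2).const_mul ε
    refine ((dd₁.hasDerivAt.sub dd₂.hasDerivAt).sub this).deriv.trans ?_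
    ring
  have hconc : deriv (deriv fun y => φ (t, y)) x ≤ 0 := by
    by_contra! hp
    have hmin := isLocalMin_of_deriv_deriv_pos hp hloc.deriv_eq_zero
      hderiv.self_of_nhds.continuousAt
    -- A point that is both a local maximum and a local minimum has a constant neighbourhood.
    have hc : (fun y => φ (t, y)) =ᶠ[𝓝 x] fun _ => φ (t, x) := by
      filter_upwards [hmin, hloc] with y e₁ e₂ using le_antisymm e₂ e₁
    rw [hc.deriv.deriv_eq] at hp
    simp at hp
  have hjump := hmax' t 0 ht0 htt le_rfl hR0.le
  have htime := ((h₁.equation t x htpos hxpos).sub (h₂.equation t x htpos hxpos)).sub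
    ((((hasDerivAt_id t).const_mul (3 + (r : ℝ))).const_add ((x - 1) ^ 2)).const_mul ε)
  have htime_nonneg : 0 ≤ deriv (deriv (v₁ t)) x + r * (v₁ t 0 - v₁ t x)
      - (deriv (deriv (v₂ t)) x + r * (v₂ t 0 - v₂ t x)) - ε * ((3 + (r : ℝ)) * 1) := by
    refine (htime.hasDerivWithinAt (s := Iic t)).nonneg_of_eventually_le ?_
    filter_upwards [Ioo_mem_nhdsLT htpos] with s hs
    have := hmax' s x hs.1.le (hs.2.le.trans htt) hx0 hxR
    simp only [hφ] at this
    simp only [Pi.sub_apply, id]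
    linarith
  rw [hderiv2] at hconc
  simp only [hφ] at hjump
  have hr : (0 : ℝ) ≤ r := r.2
  have := mul_nonneg hr (show 0 ≤ ε - ((v₁ t 0 - v₂ t 0) - (v₁ t x - v₂ t x)) by
    nlinarith [sq_nonneg (x - 1)])
  nlinarith

/-! ### The classical solution -/

/-- The classical solution with datum `F`, for an even function `F` on the line. -/
noncomputable def resettingHeat (r : ℝ) (F : ℝ → ℝ) (t x : ℝ) : ℝ :=
  Real.exp (-(r * t)) * heat F t x + ∫ s in (0 : ℝ)..t, r * Real.exp (-(r * s)) * heat F s 0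

lemma continuous_resettingHeat {F : ℝ → ℝ} (hF : Continuous F) {M : ℝ} (hM : ∀ y, |F y| ≤ M)
    (r : ℝ) : Continuous (Function.uncurry (resettingHeat r F)) := by
  have hc : Continuous fun s => r * Real.exp (-(r * s)) * heat F s 0 :=
    (by fun_prop : Continuous fun s => r * Real.exp (-(r * s))).mul
      ((continuous_heat hF hM).comp (f := fun s : ℝ => (s, (0 : ℝ))) (by fun_prop))
  have hi : Continuous fun t => ∫ s in (0 : ℝ)..t, r * Real.exp (-(r * s)) * heat F s 0 :=
    intervalIntegral.continuous_primitive (fun a b => hc.intervalIntegrable a b) 0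
  exact ((by fun_prop : Continuous fun p : ℝ × ℝ => Real.exp (-(r * p.1))).mul
    (continuous_heat hF hM)).add (hi.comp continuous_fst)

lemma hasDerivAt_resettingHeat_time {F : ℝ → ℝ} (hF : Continuous F) {M : ℝ}
    (hM : ∀ y, |F y| ≤ M) (r : ℝ) {t : ℝ} (ht : 0 < t) (x : ℝ) :
    HasDerivAt (fun s => resettingHeat r F s x)
      (deriv (deriv (resettingHeat r F t)) x
        + r * (resettingHeat r F t 0 - resettingHeat r F t x)) t := by
  have hc : Continuous fun s => r * Real.exp (-(r * s)) * heat F s 0 :=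
    (by fun_prop : Continuous fun s => r * Real.exp (-(r * s))).mul
      ((continuous_heat hF hM).comp (f := fun s : ℝ => (s, (0 : ℝ))) (by fun_prop))
  have hd : deriv (deriv (resettingHeat r F t)) x
      = Real.exp (-(r * t)) * deriv (deriv (heat F t)) x := by
    have h1 : deriv (resettingHeat r F t)
        = fun x => Real.exp (-(r * t)) * deriv (heat F t) x := by
      ext y
      have := (hasDerivAt_heat hF hM ht y).differentiableAt.hasDerivAt
      exact ((this.const_mul (Real.exp (-(r * t)))).add_const _).deriv
    rw [h1]
    exact ((hasDerivAt_deriv_heat hF hM ht x).differentiableAt.hasDerivAt.const_mul _).deriv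
  have h1 : HasDerivAt (fun s => Real.exp (-(r * s))) (Real.exp (-(r * t)) * -r) t := by
    have := ((hasDerivAt_id t).const_mul r).neg.exp
    exact this.congr_deriv (by simp)
  have h2 : HasDerivAt (fun t => ∫ s in (0 : ℝ)..t, r * Real.exp (-(r * s)) * heat F s 0)
      (r * Real.exp (-(r * t)) * heat F t 0) t :=
    (hc.integral_hasStrictDerivAt 0 t).hasDerivAt
  refine ((h1.mul (hasDerivAt_heat_time hF hM ht x)).add h2).congr_deriv ?_
  rw [hd]
  simp only [resettingHeat]
  ring

/-- The function `f` on the half-line, extended to an even function on the line. -/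
noncomputable def evenExtension (f : ℝ≥0 →ᵇ ℝ) (y : ℝ) : ℝ := f (Real.nnabs y)

lemma continuous_evenExtension (f : ℝ≥0 →ᵇ ℝ) : Continuous (evenExtension f) :=
  f.continuous.comp (continuous_abs.subtype_mk _)

lemma isResettingHeatSolution_resettingHeat (r : ℝ≥0) (f : ℝ≥0 →ᵇ ℝ) :
    IsResettingHeatSolution r f (resettingHeat r (evenExtension f)) := by
  have hF := continuous_evenExtension f
  have hM : ∀ y, |evenExtension f y| ≤ ‖f‖ := fun y => f.norm_coe_le_norm _
  have heven : ∀ y, evenExtension f (-y) = evenExtension f y := fun y => by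
    simp only [evenExtension]
    congr 1
    ext
    simp
  refine ⟨(continuous_resettingHeat hF hM r).continuousOn, fun t ht => ?_,
    fun t x ht _ => hasDerivAt_resettingHeat_time hF hM r ht x, fun t ht => ?_, fun x => ?_⟩
  · exact ((contDiff_const.mul (contDiff_heat hF hM ht)).add contDiff_const).contDiffOn
  · have := ((hasDerivAt_heat_zero hF hM heven ht).const_mul (Real.exp (-(r * t)))).add_const
      (∫ s in (0 : ℝ)..t, r * Real.exp (-(r * s)) * heat (evenExtension f) s 0)
    exact (this.congr_deriv (mul_zero _)).hasDerivWithinAt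
  · have : Real.nnabs x = x := by ext; simp
    simp [resettingHeat, heat, evenExtension, this]

/-- Only the values on the closed quadrant matter for being a solution. -/
lemma IsResettingHeatSolution.congr {r : ℝ≥0} {f : ℝ≥0 →ᵇ ℝ} {u v : ℝ → ℝ → ℝ}
    (hv : IsResettingHeatSolution r f v) (h : ∀ t x : ℝ, 0 ≤ t → 0 ≤ x → u t x = v t x) :
    IsResettingHeatSolution r f u := by
  refine ⟨hv.cont.congr fun p hp => h _ _ hp.1 hp.2, fun t ht => ?_, fun t x ht hx => ?_,
    fun t ht => ?_, fun x => (h _ _ le_rfl x.2).trans (hv.initial x)⟩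
  · exact (hv.contDiff_space t ht).congr fun x hx => h _ _ ht.le (le_of_lt hx)
  · have e : u t =ᶠ[𝓝 x] v t := by
      filter_upwards [Ioi_mem_nhds hx] with y hy using h _ _ ht.le (le_of_lt hy)
    rw [e.deriv.deriv_eq, h t 0 ht.le le_rfl, h t x ht.le hx.le]
    refine (hv.equation t x ht hx).congr_of_eventuallyEq ?_
    filter_upwards [Ioi_mem_nhds ht] with s hs using h _ _ (le_of_lt hs) hx.le
  · exact (hv.neumann t ht).congr (fun x hx => h _ _ ht.le hx) (h _ _ ht.le le_rfl)

lemma IsReflectingResettingBrownian.integral_eq {Ω : Type*} [MeasurableSpace Ω] {P : Measure Ω}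
    {r x : ℝ≥0} {X : ℝ≥0 → Ω → ℝ≥0} (hX : IsReflectingResettingBrownian r x X P) (f : ℝ≥0 →ᵇ ℝ)
    (t : ℝ≥0) : Integrable (fun ω => f (X t ω)) P ∧
      ∫ ω, f (X t ω) ∂P = resettingHeat r (evenExtension f) t x := by
  obtain ⟨Y, hY, hXY⟩ := hX
  have h : ∀ ω, f (X t ω) = evenExtension f (Y t ω) := fun ω => by
    rw [evenExtension]
    congr 1
    ext
    simp [hXY]
  simp only [h]
  exact hY.integral_comp (continuous_evenExtension f) (fun y => f.norm_coe_le_norm _) t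

lemma IsReflectingResettingBrownian.isProbabilityMeasure {Ω : Type*} [MeasurableSpace Ω]
    {P : Measure Ω} {r x : ℝ≥0} {X : ℝ≥0 → Ω → ℝ≥0}
    (hX : IsReflectingResettingBrownian r x X P) : IsProbabilityMeasure P := by
  obtain ⟨_, ⟨_, _, hB, _⟩, _⟩ := hX
  exact (hB.hasLaw 0).isProbabilityMeasure

theorem mainTheorem8 (r : ℝ≥0) (f : ℝ≥0 →ᵇ ℝ)
    {Ω : ℝ≥0 → Type*} [∀ x, MeasurableSpace (Ω x)] (P : ∀ x, Measure (Ω x))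
    (X : ∀ x, ℝ≥0 → Ω x → ℝ≥0)
    (hX : ∀ x, IsReflectingResettingBrownian r x (X x) (P x))
    (u : ℝ → ℝ → ℝ) (hu : ∀ t x : ℝ≥0, u t x = ∫ ω, f (X x t ω) ∂(P x)) :
    (∀ t x : ℝ≥0, Integrable (fun ω => f (X x t ω)) (P x)) ∧
    IsResettingHeatSolution r f u ∧
    (∀ t x : ℝ≥0, |u t x| ≤ ‖f‖) ∧
    ∀ v : ℝ → ℝ → ℝ, IsResettingHeatSolution r f v →
      (∃ C : ℝ, ∀ t x : ℝ≥0, |v t x| ≤ C) →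
      ∀ t x : ℝ≥0, v t x = u t x := by
  have hsol : IsResettingHeatSolution r f u := by
    refine (isResettingHeatSolution_resettingHeat r f).congr fun t x ht hx => ?_
    lift t to ℝ≥0 using ht
    lift x to ℝ≥0 using hx
    exact (hu t x).trans ((hX x).integral_eq f t).2
  have hbd : ∀ t x : ℝ≥0, |u t x| ≤ ‖f‖ := fun t x => by
    have := (hX x).isProbabilityMeasure
    have := norm_integral_le_of_norm_le_const (μ := P x) (f := fun ω => f (X x t ω))
      (Eventually.of_forall fun ω => f.norm_coe_le_norm _)
    simpa [hu] using this
  refine ⟨fun t x => ((hX x).integral_eq f t).1, hsol, hbd, ?_⟩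
  rintro v hv ⟨C, hC⟩ t x
  exact le_antisymm (hv.le_of_bounded hsol hC hbd t x) (hsol.le_of_bounded hv hbd hC t x)
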